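/- Let $n\ge 1$, let $A\in\mathbb{R}_+^{n\times n}$ be an entrywise nonnegative irreducible matrix (for $n=1$ this means $A>0$) and let $b\in\mathbb{R}_+^n$ be an entrywise nonnegative vector such that the controllability matrix $\mathrm{conmat}_n(A,b)=[\,b\ \ Ab\ \cdots\ A^{n-1}b\,]$ has rank $n$. For $k\in\mathbb{N}$ let $\mathrm{Conset}_k(A,b)\subseteq\mathbb{R}^n_+$ be the set of states $x(k)$ reached at time $k$ by the system $x(t+1)=Ax(t)+b\,u(t)$, $x(0)=0$, under nonnegative inputs $u(0),\dots,u(k-1)\ge 0$, and let $\mathrm{Conset}_{\mathrm f}(A,b)=\bigcup_{k\ge 0}\mathrm{Conset}_k(A,b)$. When it exists, let the vertex number $k_{\mathrm{vert}}$ be the smallest integer $k\ge 1$ with $A^{k}b\in\mathrm{Conset}_k(A,b)$. Call a subset of $\mathbb{R}^n$ a polyhedral cone if it consists of all nonnegative linear combinations of some finite set of vectors. Let $\mathrm{spec}$ denote the set of complex eigenvalues and $\rho(A)$ the spectral radius. Then there exist a nonsingular real matrix $S$ and $A_2\in\mathbb{R}^{(n-1)\times(n-1)}$ with $$A=S\begin{pmatrix}\rho(A)&0\\0&A_2\end{pmatrix}S^{-1},\qquad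 \mathrm{spec}(A_2)=\mathrm{spec}(A)\setminus\{\rho(A)\},$$ and for every such decomposition the following statements are equivalent: (a) $\mathrm{Conset}_{\mathrm f}(A,b)$ is a polyhedral cone; (a$'$) $k_{\mathrm{vert}}$ exists and there is an integer $k^*\ge k_{\mathrm{vert}}$ with $\mathrm{Conset}_{\mathrm f}(A,b)=\mathrm{Conset}_{k^*}(A,b)$; (b) $A$ has a nonnegative recursion: there are $n_m\in\mathbb{N}$ and $c_0,\dots,c_{n_m-1}\ge 0$ with $A^{n_m}=\sum_{i=0}^{n_m-1}c_iA^i$; (c) $A_2$ has no eigenvalue in $(0,\infty)$. -/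

import Mathlib

namespace PositiveSystem

/-- The state `x(t)` of the single-input system `x(t+1) = A x(t) + u(t) b`, `x(0) = x₀`. -/
def state {n : ℕ} (A : Matrix (Fin n) (Fin n) ℝ) (b x₀ : Fin n → ℝ) (u : ℕ → ℝ) :
    ℕ → Fin n → ℝ
  | 0 => x₀
  | t + 1 => A.mulVec (state A b x₀ u t) + u t • b

/-- The `k`-step controllable subset (from the initial state `0`): the states in the nonnegative
orthant that are reached at time `k` under some nonnegative input signal. -/
def conset {n : ℕ} (k : ℕ) (A : Matrix (Fin n) (Fin n) ℝ) (b : Fin n → ℝ) :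
    Set (Fin n → ℝ) :=
  {x | (∀ i, 0 ≤ x i) ∧ ∃ u : ℕ → ℝ, (∀ t, 0 ≤ u t) ∧ state A b 0 u k = x}

/-- The finite controllable subset: the states reachable from `0` in some finite time. -/
def consetF {n : ℕ} (A : Matrix (Fin n) (Fin n) ℝ) (b : Fin n → ℝ) : Set (Fin n → ℝ) :=
  ⋃ k : ℕ, conset k A b

/-- The controllability matrix `[b, Ab, …, A^(k-1) b]`. -/
def conmat {n : ℕ} (k : ℕ) (A : Matrix (Fin n) (Fin n) ℝ) (b : Fin n → ℝ) :
    Matrix (Fin n) (Fin k) ℝ :=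
  Matrix.of fun i j => ((A ^ (j : ℕ)).mulVec b) i

/-- A set is a polyhedral cone if it consists of all nonnegative linear combinations of a finite
set of vectors. -/
def IsPolyhedralCone {n : ℕ} (K : Set (Fin n → ℝ)) : Prop :=
  ∃ C : PointedCone ℝ (Fin n → ℝ), C.FG ∧ (C : Set (Fin n → ℝ)) = K

/-- `k` is the vertex number of the finite controllable subset: the smallest positive integer
with `A^k b ∈ Conset_k(A, b)`. -/
def IsVertexNumber {n : ℕ} (A : Matrix (Fin n) (Fin n) ℝ) (b : Fin n → ℝ) (k : ℕ) : Prop :=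
  IsLeast {j : ℕ | 0 < j ∧ (A ^ j).mulVec b ∈ conset j A b} k

/-- `A^N = ∑_{i < N} c_i A^i` for some `N` and some nonnegative `c_i`. -/
def HasNonnegRecursion {n : ℕ} (A : Matrix (Fin n) (Fin n) ℝ) : Prop :=
  ∃ (N : ℕ) (c : Fin N → ℝ), (∀ i, 0 ≤ c i) ∧ A ^ N = ∑ i : Fin N, c i • A ^ (i : ℕ)

/-- The set of complex eigenvalues of a real matrix. -/
def spec {n : ℕ} (A : Matrix (Fin n) (Fin n) ℝ) : Set ℂ :=
  spectrum ℂ (A.map (fun r : ℝ => (r : ℂ)))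

/-- The spectral radius of a real matrix: the largest modulus of a complex eigenvalue. -/
noncomputable def rho {n : ℕ} (A : Matrix (Fin n) (Fin n) ℝ) : ℝ :=
  (spectralRadius ℂ (A.map (fun r : ℝ => (r : ℂ)))).toReal

/-- `A = S diag(ρ(A), A₂) S⁻¹` with `S` real and nonsingular and
`spec(A₂) = spec(A) \ {ρ(A)}`. The columns of `S` (the rows of its inverse `T`) are indexed by
the blocks of sizes `1` and `n - 1`. -/
structure IsPerronDecomposition {n : ℕ} (A : Matrix (Fin n) (Fin n) ℝ)
    (S : Matrix (Fin n) (Fin 1 ⊕ Fin (n - 1)) ℝ)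
    (T : Matrix (Fin 1 ⊕ Fin (n - 1)) (Fin n) ℝ)
    (A₂ : Matrix (Fin (n - 1)) (Fin (n - 1)) ℝ) : Prop where
  mul_inv : S * T = 1
  inv_mul : T * S = 1
  eq_mul : A = S * Matrix.fromBlocks (Matrix.of fun (_ _ : Fin 1) => rho A) 0 0 A₂ * T
  spec_eq : spec A₂ = spec A \ {(rho A : ℂ)}

end PositiveSystem

/-!
The set reached in `k` steps is the cone generated by `b, A b, …, A ^ (k - 1) b`
(`conset_eq_krylovCone`). These cones increase with `k`, so their union is polyhedral only if it
is one of them, which puts some `A ^ N b` into the cone of the earlier iterates; since `b` is a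
cyclic vector, this relation between vectors is a relation between powers of `A`, a nonnegative
recursion. Conversely a recursion makes the chain of cones stationary.

It remains to compare recursions with the positive spectrum. A polynomial `X ^ N - ∑ c i X ^ i`
with `c i ≥ 0` has at most one positive root (`eq_of_pow_eq_sum`), so a recursion leaves no
positive eigenvalue besides `ρ(A)`. For the converse, suppose that `ρ = ρ(A)` is the only positive
eigenvalue, and let `p` be the characteristic polynomial.

* Perron–Frobenius theory: `ρ` is an eigenvalue with positive right and left eigenvectors
  (`exists_isPerronTriple`), it is a simple root of `p`, which also gives the block decomposition
  (`IsPerronTriple.exists_splitting`), and every eigenvalue `ω ρ` with `‖ω‖ = 1` yields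
  `p(ω t) = ω ^ n p(t)` (`IsPerronTriple.pow_eq_one_of_coeff_ne_zero`).
* With `d` the greatest common divisor of the degree gaps of `p`, write `p = X ^ r * g(X ^ d)` with
  `g(0) ≠ 0`. By the symmetry, `σ = ρ ^ d` is the only root of `g` of maximal modulus; it is
  simple, and no other root of `g` lies in `[0, ∞)` (`exists_dvd_X_pow_sub_of_rotation`).
* So `g = (X - σ) q` with `q` free of roots in `[0, ∞)`. Such a `q` divides some `Q` that has
  positive coefficients and still has its roots in the disc `‖z‖ < σ` (`exists_dvd_coeff_pos`). The
  remainder of `X ^ N` modulo `(X - σ) Q` is asymptotic to `σ ^ N Q / Q(σ)`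
  (`eventually_coeff_modByMonic_nonneg`), so it is a nonnegative polynomial `R` for some large `N`.
  Hence `g` divides `X ^ N - R`, and `p` divides `X ^ r (X ^ (d N) - R(X ^ d))`; by
  Cayley–Hamilton this is a nonnegative recursion of `A`.
-/

namespace PositiveSystem

open Polynomial

/-! ### Polynomials with nonnegative remainders -/

section Polynomials

open Filter Topology

/-- A sequence that obeys `w (k + 1) = a * w k + o(1)` with `‖a‖ < 1` tends to zero. -/
lemma tendsto_zero_of_succ_sub_mul {w : ℕ → ℂ} {a : ℂ} (ha : ‖a‖ < 1)
    (h : Tendsto (fun k => w (k + 1) - a * w k) atTop (𝓝 0)) : Tendsto w atTop (𝓝 0) := by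
  rw [Metric.tendsto_atTop] at h ⊢
  intro ε hε
  obtain ⟨M, hM⟩ := h ((1 - ‖a‖) * (ε / 2)) (by nlinarith)
  have key : ∀ k, ‖w (M + k)‖ ≤ ‖a‖ ^ k * ‖w M‖ + ε / 2 := by
    intro k
    induction k with
    | zero => simp; positivity
    | succ k ih =>
      have h1 := hM (M + k) (by omega)
      rw [dist_zero_right] at h1
      have h2 : ‖w (M + k + 1)‖ ≤ ‖w (M + k + 1) - a * w (M + k)‖ + ‖a‖ * ‖w (M + k)‖ := by
        have := norm_add_le (w (M + k + 1) - a * w (M + k)) (a * w (M + k))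
        rwa [sub_add_cancel, norm_mul] at this
      have h3 := mul_le_mul_of_nonneg_left ih (norm_nonneg a)
      rw [← add_assoc, pow_succ]
      nlinarith
  have h4 : Tendsto (fun k => ‖a‖ ^ k * ‖w M‖) atTop (𝓝 0) := by
    simpa using (tendsto_pow_atTop_nhds_zero_of_lt_one (norm_nonneg a) ha).mul_const ‖w M‖
  obtain ⟨K, hK⟩ := (h4.eventually (gt_mem_nhds (half_pos hε))).exists_forall_of_atTop
  refine ⟨M + K, fun k hk => ?_⟩
  obtain ⟨j, rfl⟩ : ∃ j, k = M + j := ⟨k - M, by omega⟩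
  rw [dist_zero_right]
  linarith [key j, hK j (by omega)]

lemma prod_X_sub_C_roots {p : ℂ[X]} (hp : p.Monic) :
    (p.roots.map fun z => X - C z).prod = p := by
  have := (IsAlgClosed.splits p).eq_prod_roots
  rw [hp.leadingCoeff, C_1, one_mul] at this
  exact this.symm

/-- If a linear functional is `o(ρ ^ N)` on the multiples `P * X ^ N` of a polynomial `P` with
roots in the disc `‖z‖ < ρ`, then it is `o(ρ ^ N)` on `X ^ N`: the linear factors of `P` can be
removed one by one, each step being a contraction. -/
lemma tendsto_zero_of_functional {ρ : ℝ} (hρ : 0 < ρ) (s : Multiset ℂ) (hs : ∀ z ∈ s, ‖z‖ < ρ)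
    (ψ : ℂ[X] →ₗ[ℂ] ℂ)
    (h : Tendsto (fun N => ψ ((s.map fun z => X - C z).prod * X ^ N) / (ρ : ℂ) ^ N) atTop (𝓝 0)) :
    Tendsto (fun N => ψ (X ^ N) / (ρ : ℂ) ^ N) atTop (𝓝 0) := by
  have hρ' : (ρ : ℂ) ≠ 0 := by exact_mod_cast hρ.ne'
  induction s using Multiset.induction_on with
  | empty => simpa using h
  | cons a s ih =>
    refine ih (fun z hz => hs z (Multiset.mem_cons_of_mem hz)) ?_
    refine tendsto_zero_of_succ_sub_mul (a := a / ρ) ?_ ?_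
    · rw [norm_div, Complex.norm_real, Real.norm_of_nonneg hρ.le, div_lt_one hρ]
      exact hs a (Multiset.mem_cons_self a s)
    · have h1 := h.mul_const ((ρ : ℂ)⁻¹)
      rw [zero_mul] at h1
      refine h1.congr fun N => ?_
      have : ((a ::ₘ s).map fun z => X - C z).prod * X ^ N
          = (s.map fun z => X - C z).prod * X ^ (N + 1)
            - a • ((s.map fun z => X - C z).prod * X ^ N) := by
        rw [Multiset.map_cons, Multiset.prod_cons, smul_eq_C_mul]
        ring
      rw [this, map_sub, map_smul, smul_eq_mul, pow_succ (ρ : ℂ)]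
      field_simp

/-- If `Q` is a real monic polynomial all of whose coefficients are positive and whose complex
roots lie in the disc `‖z‖ < ρ`, then the remainder of `X ^ N` modulo `(X - ρ) * Q`, divided by
`ρ ^ N`, converges to `Q / Q(ρ)`; so its coefficients are nonnegative for large `N`. -/
lemma eventually_coeff_modByMonic_nonneg {ρ : ℝ} (hρ : 0 < ρ) {Q : ℝ[X]} (hQ : Q.Monic)
    (hpos : ∀ j ≤ Q.natDegree, 0 < Q.coeff j)
    (hroot : ∀ z : ℂ, aeval z Q = 0 → ‖z‖ < ρ) (j : ℕ) :
    ∀ᶠ N in atTop, 0 ≤ (X ^ N %ₘ ((X - C ρ) * Q)).coeff j := by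
  have hW : ((X - C ρ) * Q).Monic := (monic_X_sub_C ρ).mul hQ
  have hWdeg : ((X - C ρ) * Q).natDegree = Q.natDegree + 1 := by
    rw [(monic_X_sub_C ρ).natDegree_mul hQ, natDegree_X_sub_C, add_comm]
  rcases lt_or_ge Q.natDegree j with hj | hj
  · refine Eventually.of_forall fun N => le_of_eq ?_
    rw [coeff_eq_zero_of_natDegree_lt]
    have := natDegree_modByMonic_lt (X ^ N) hW (by intro h; simp [h] at hWdeg)
    omega
  have hQρ : 0 < Q.eval ρ := by
    rw [eval_eq_sum_range]
    exact Finset.sum_pos (fun i hi => mul_pos (hpos i (by simpa [Nat.lt_succ_iff] using hi))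
      (pow_pos hρ i)) ⟨0, by simp⟩
  set ι : ℝ →+* ℂ := algebraMap ℝ ℂ with hι
  set W : ℂ[X] := ((X - C ρ) * Q).map ι with hWdef
  have hWm : W.Monic := hW.map ι
  set κ : ℂ := ((Q.coeff j / Q.eval ρ : ℝ) : ℂ) with hκ
  have hρ' : (ρ : ℂ) ≠ 0 := by exact_mod_cast hρ.ne'
  -- `ψ` measures the deviation of the `j`-th coefficient of the remainder from the claimed limit.
  -- It vanishes on `Q * X ^ N`, because `Q * X ^ N` is congruent to `ρ ^ N * Q`.
  let ψ : ℂ[X] →ₗ[ℂ] ℂ := (lcoeff ℂ j) ∘ₗ (modByMonicHom W) - κ • leval (ρ : ℂ)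
  have hψ : ∀ F, ψ F = (F %ₘ W).coeff j - κ * F.eval (ρ : ℂ) := fun F => rfl
  have hzero : ∀ N, ψ (Q.map ι * X ^ N) = 0 := by
    intro N
    have h1 : (Q.map ι * X ^ N) %ₘ W = C ((ρ : ℂ) ^ N) * Q.map ι := by
      have h2 : (Q.map ι * X ^ N - C ((ρ : ℂ) ^ N) * Q.map ι) %ₘ W = 0 := by
        rw [modByMonic_eq_zero_iff_dvd hWm]
        have h3 : (X - C (ρ : ℂ)) ∣ X ^ N - C (ρ : ℂ) ^ N := sub_dvd_pow_sub_pow _ _ _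
        obtain ⟨t, ht⟩ := h3
        refine ⟨t, ?_⟩
        have : W = (X - C (ρ : ℂ)) * Q.map ι := by simp [hWdef, hι]
        rw [this, C_pow]
        linear_combination (Q.map ι) * ht
      have h3 : (C ((ρ : ℂ) ^ N) * Q.map ι) %ₘ W = C ((ρ : ℂ) ^ N) * Q.map ι := by
        rw [modByMonic_eq_self_iff hWm]
        rw [degree_C_mul (pow_ne_zero N hρ'), degree_map, hWdef, degree_map]
        refine degree_lt_degree ?_
        omega
      rw [sub_modByMonic, sub_eq_zero] at h2
      rw [h2, h3]
    rw [hψ, h1, coeff_C_mul, coeff_map, eval_mul, eval_pow, eval_X, eval_map]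
    have h4 : eval₂ ι (ρ : ℂ) Q = ((Q.eval ρ : ℝ) : ℂ) := by
      have : (ρ : ℂ) = ι ρ := rfl
      rw [this, eval₂_at_apply]; rfl
    have h5 : ι (Q.coeff j) = κ * ((Q.eval ρ : ℝ) : ℂ) := by
      rw [hκ, ← Complex.ofReal_mul, div_mul_cancel₀ _ hQρ.ne']; rfl
    rw [h4, h5]; ring
  have hlim : Tendsto (fun N => ψ (X ^ N) / (ρ : ℂ) ^ N) atTop (𝓝 0) := by
    refine tendsto_zero_of_functional hρ (Q.map ι).roots ?_ ψ ?_
    · intro z hz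
      apply hroot
      rw [mem_roots (hQ.map ι).ne_zero, IsRoot, eval_map] at hz
      simpa [aeval_def] using hz
    · rw [prod_X_sub_C_roots (hQ.map ι)]; simp [hzero]
  have hev := Tendsto.eventually_lt_const (by simpa using div_pos (hpos j hj) hQρ :
    ‖(0 : ℂ)‖ < Q.coeff j / Q.eval ρ) hlim.norm
  filter_upwards [hev] with N hN
  have h6 : ψ (X ^ N) / (ρ : ℂ) ^ N
      = (((X ^ N %ₘ ((X - C ρ) * Q)).coeff j / ρ ^ N - Q.coeff j / Q.eval ρ : ℝ) : ℂ) := by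
    have h7 : (X ^ N %ₘ W) = ((X ^ N %ₘ ((X - C ρ) * Q))).map ι := by
      rw [map_modByMonic ι hW, Polynomial.map_pow, map_X]
    rw [hψ, h7, coeff_map, eval_pow, eval_X]
    change (((X ^ N %ₘ ((X - C ρ) * Q)).coeff j : ℝ) - κ * (ρ : ℂ) ^ N) / (ρ : ℂ) ^ N = _
    rw [Complex.ofReal_sub, Complex.ofReal_div, Complex.ofReal_pow, ← hκ]
    field_simp
  rw [h6, Complex.norm_real, Real.norm_eq_abs, abs_lt] at hN
  have h8 : 0 < (X ^ N %ₘ ((X - C ρ) * Q)).coeff j / ρ ^ N := by linarith [hN.1]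
  exact ((div_pos_iff_of_pos_right (pow_pos hρ N)).1 h8).le

lemma exists_pow_re_nonpos {z : ℂ} (hz : ∀ r : ℝ, 0 ≤ r → z ≠ r) :
    ∃ k : ℕ, 0 < k ∧ (z ^ k).re ≤ 0 := by
  have harg : 0 < |z.arg| := by
    rw [abs_pos]
    intro h
    rw [Complex.arg_eq_zero_iff] at h
    exact hz z.re h.1 (Complex.ext rfl (by simpa using h.2))
  have hpi : |z.arg| ≤ Real.pi := Complex.abs_arg_le_pi z
  -- For the first `k` with `k * |arg z| ≥ π / 2`, the angle still lies in `[π / 2, 3 π / 2]`.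
  set k := ⌈Real.pi / 2 / |z.arg|⌉₊ with hk
  have hk0 : 0 < k := Nat.ceil_pos.2 (by positivity)
  have h1 : Real.pi / 2 ≤ k * |z.arg| := by
    rw [← div_le_iff₀ harg]; exact Nat.le_ceil _
  have h2 : k * |z.arg| < Real.pi / 2 + |z.arg| := by
    have := Nat.ceil_lt_add_one (a := Real.pi / 2 / |z.arg|) (by positivity)
    rw [← hk] at this
    have := mul_lt_mul_of_pos_right this harg
    rwa [add_mul, div_mul_cancel₀ _ harg.ne', one_mul] at this
  refine ⟨k, hk0, ?_⟩
  have h3 : z ^ k = ((‖z‖ ^ k : ℝ) : ℂ) * Complex.exp ((k * z.arg : ℝ) * Complex.I) := by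
    conv_lhs => rw [← Complex.norm_mul_exp_arg_mul_I z]
    rw [mul_pow, ← Complex.exp_nat_mul]
    push_cast
    ring_nf
  rw [h3, Complex.re_ofReal_mul, Complex.exp_ofReal_mul_I_re]
  refine mul_nonpos_of_nonneg_of_nonpos (by positivity) ?_
  have h4 : Real.cos (k * z.arg) = Real.cos (k * |z.arg|) := by
    rw [← Real.cos_abs (k * z.arg), abs_mul, Nat.abs_cast]
  rw [h4]
  exact Real.cos_nonpos_of_pi_div_two_le_of_le h1 (by linarith)

/-- The witness is `X ^ (2k) - 2 Re(z ^ k) X ^ k + ‖z‖ ^ (2k)` with `k` such that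
`Re(z ^ k) ≤ 0`. -/
lemma exists_monic_coeff_nonneg_of_root {z : ℂ} (hz : ∀ r : ℝ, 0 ≤ r → z ≠ r) :
    ∃ P : ℝ[X], P.Monic ∧ (∀ j, 0 ≤ P.coeff j) ∧ 0 < P.coeff 0 ∧ aeval z P = 0 ∧
      ∀ w : ℂ, aeval w P = 0 → ‖w‖ = ‖z‖ := by
  obtain ⟨k, hk, hre⟩ := exists_pow_re_nonpos hz
  have hz0 : z ≠ 0 := by simpa using hz 0 le_rfl
  set y := z ^ k with hy
  have hy0 : y ≠ 0 := pow_ne_zero _ hz0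
  set q : ℝ[X] := X ^ 2 + C (-2 * y.re) * X + C (‖y‖ ^ 2) with hq
  have hfac : ∀ x : ℂ, aeval x q = (x - y) * (x - (starRingEnd ℂ) y) := by
    intro x
    have h1 : y + (starRingEnd ℂ) y = 2 * (y.re : ℂ) := by
      rw [Complex.add_conj]; push_cast; ring
    have h2 : y * (starRingEnd ℂ) y = ((‖y‖ : ℂ)) ^ 2 := Complex.mul_conj' y
    simp only [hq, map_add, map_mul, map_pow, aeval_X, aeval_C, Complex.coe_algebraMap]
    push_cast
    linear_combination x * h1 - h2
  have hcoef : ∀ j, 0 ≤ q.coeff j := by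
    intro j
    have h1 : 0 ≤ ‖y‖ ^ 2 := by positivity
    have h2 : 0 ≤ -2 * y.re := by linarith
    simp only [hq, coeff_add, coeff_X_pow, coeff_C_mul, coeff_X, coeff_C]
    refine add_nonneg (add_nonneg ?_ (mul_nonneg h2 ?_)) ?_ <;> split_ifs <;>
      first | exact h1 | exact zero_le_one | exact le_rfl
  refine ⟨expand ℝ k q, ?_, ?_, ?_, ?_, ?_⟩
  · rw [monic_expand_iff hk]
    rw [hq]; monicity!
  · intro j
    rw [coeff_expand hk]
    split_ifs
    exacts [hcoef _, le_rfl]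
  · rw [coeff_expand hk]
    have h0 : q.coeff 0 = ‖y‖ ^ 2 := by
      rw [hq, coeff_add, coeff_add, coeff_C_zero, coeff_X_pow, mul_coeff_zero, coeff_X_zero]
      simp
    simp only [dvd_zero, if_true, Nat.zero_div, h0]
    positivity
  · rw [expand_aeval, hfac, sub_self, zero_mul]
  · intro w hw
    rw [expand_aeval, hfac, mul_eq_zero, sub_eq_zero, sub_eq_zero] at hw
    have : ‖w ^ k‖ = ‖z ^ k‖ := by
      rcases hw with h | h
      · rw [h]
      · rw [h, Complex.norm_conj]
    rw [norm_pow, norm_pow] at this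
    exact (pow_left_inj₀ (norm_nonneg _) (norm_nonneg _) hk.ne').1 this

lemma coeff_mul_nonneg {P Q : ℝ[X]} (hP : ∀ j, 0 ≤ P.coeff j) (hQ : ∀ j, 0 ≤ Q.coeff j) (j : ℕ) :
    0 ≤ (P * Q).coeff j := by
  rw [coeff_mul]
  exact Finset.sum_nonneg fun i _ => mul_nonneg (hP _) (hQ _)

/-- The factors for the single roots multiply to one that works for all of them. Working over the
complex roots with multiplicity avoids factoring into real quadratics. -/
lemma exists_monic_coeff_nonneg_of_multiset {ρ : ℝ} (s : Multiset ℂ) (hs : ∀ z ∈ s, ‖z‖ < ρ)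
    (hs' : ∀ z ∈ s, ∀ r : ℝ, 0 ≤ r → z ≠ r) :
    ∃ P : ℝ[X], P.Monic ∧ (∀ j, 0 ≤ P.coeff j) ∧ 0 < P.coeff 0 ∧
      (s.map fun z => X - C z).prod ∣ P.map (algebraMap ℝ ℂ) ∧
      ∀ w : ℂ, aeval w P = 0 → ‖w‖ < ρ := by
  induction s using Multiset.induction_on with
  | empty =>
    refine ⟨1, monic_one, fun j => ?_, by simp, by simp, by simp⟩
    rw [coeff_one]; split_ifs <;> simp
  | cons a s ih =>
    obtain ⟨P, hP, hPc, hP0, hPd, hPr⟩ := ih (fun z hz => hs z (Multiset.mem_cons_of_mem hz))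
      (fun z hz => hs' z (Multiset.mem_cons_of_mem hz))
    obtain ⟨R, hR, hRc, hR0, hRd, hRr⟩ :=
      exists_monic_coeff_nonneg_of_root (hs' a (Multiset.mem_cons_self a s))
    refine ⟨R * P, hR.mul hP, coeff_mul_nonneg hRc hPc, ?_, ?_, ?_⟩
    · rw [mul_coeff_zero]; exact mul_pos hR0 hP0
    · rw [Multiset.map_cons, Multiset.prod_cons, Polynomial.map_mul]
      refine mul_dvd_mul ?_ hPd
      rw [dvd_iff_isRoot, IsRoot, eval_map]
      simpa [aeval_def] using hRd
    · intro w hw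
      rw [map_mul, mul_eq_zero] at hw
      rcases hw with h | h
      · rw [hRr w h]; exact hs a (Multiset.mem_cons_self a s)
      · exact hPr w h

/-- A real polynomial without roots in `[0, ∞)` divides one with positive coefficients. The bound
on the moduli of the roots survives. -/
lemma exists_dvd_coeff_pos {ρ : ℝ} (hρ : 0 < ρ) {q : ℝ[X]} (hq : q.Monic)
    (hroot : ∀ z : ℂ, aeval z q = 0 → ‖z‖ < ρ ∧ ∀ r : ℝ, 0 ≤ r → z ≠ r) :
    ∃ Q : ℝ[X], Q.Monic ∧ q ∣ Q ∧ (∀ j ≤ Q.natDegree, 0 < Q.coeff j) ∧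
      ∀ z : ℂ, aeval z Q = 0 → ‖z‖ < ρ := by
  have hmem : ∀ z ∈ (q.map (algebraMap ℝ ℂ)).roots, aeval z q = 0 := by
    intro z hz
    rw [mem_roots (hq.map _).ne_zero, IsRoot, eval_map] at hz
    simpa [aeval_def] using hz
  obtain ⟨P, hP, hPc, hP0, hPd, hPr⟩ := exists_monic_coeff_nonneg_of_multiset
    (q.map (algebraMap ℝ ℂ)).roots (fun z hz => (hroot z (hmem z hz)).1)
    (fun z hz => (hroot z (hmem z hz)).2)
  rw [prod_X_sub_C_roots (hq.map _), map_dvd_map'] at hPd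
  set m := P.natDegree with hm
  -- The factor `(X + ρ/2) ^ m` fills the gaps between the nonzero coefficients of `P`.
  set E : ℝ[X] := (X + C (ρ / 2)) ^ m with hE
  have hEm : E.Monic := (monic_X_add_C _).pow m
  have hEc : ∀ j, E.coeff j = (ρ / 2) ^ (m - j) * (m.choose j : ℝ) := fun j =>
    coeff_X_add_C_pow _ _ _
  have hEc0 : ∀ j, 0 ≤ E.coeff j := fun j => by rw [hEc]; positivity
  have hEpos : ∀ j ≤ m, 0 < E.coeff j := fun j hj => by
    rw [hEc]
    have := Nat.choose_pos hj
    positivity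
  have hEdeg : E.natDegree = m := by rw [hE, natDegree_pow, natDegree_X_add_C, mul_one]
  refine ⟨P * E, hP.mul hEm, hPd.mul_right E, ?_, ?_⟩
  · intro j hj
    rw [hP.natDegree_mul hEm, hEdeg] at hj
    rw [coeff_mul]
    refine Finset.sum_pos' (fun i _ => mul_nonneg (hPc _) (hEc0 _)) ?_
    rcases le_total j m with h | h
    · exact ⟨(0, j), by simp, mul_pos hP0 (hEpos j h)⟩
    · refine ⟨(m, j - m), by simp; omega, mul_pos ?_ (hEpos _ (by omega))⟩
      rw [hm, coeff_natDegree, hP.leadingCoeff]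
      exact one_pos
  · intro z hz
    rw [map_mul, mul_eq_zero] at hz
    rcases hz with h | h
    · exact hPr z h
    · rw [hE, map_pow] at h
      have h2 : z = -((ρ / 2 : ℝ) : ℂ) := by
        have := eq_zero_of_pow_eq_zero h
        rw [map_add, aeval_X, aeval_C] at this
        exact eq_neg_of_add_eq_zero_left this
      rw [h2, norm_neg, Complex.norm_real, Real.norm_of_nonneg (by positivity)]
      linarith

/-- A polynomial with a simple dominant positive root `ρ` and no other root in `[0, ∞)` divides
some `X ^ N - R` with `R` nonnegative of degree `< N`: replace the cofactor `q` by a multiple `Q`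
with positive coefficients, and let `R` be the remainder of `X ^ N` modulo `(X - ρ) * Q`. -/
lemma exists_dvd_X_pow_sub {ρ : ℝ} (hρ : 0 < ρ) {q : ℝ[X]} (hq : q.Monic)
    (hroot : ∀ z : ℂ, aeval z q = 0 → ‖z‖ < ρ ∧ ∀ r : ℝ, 0 ≤ r → z ≠ r) :
    ∃ (N : ℕ) (R : ℝ[X]), (X - C ρ) * q ∣ X ^ N - R ∧ (∀ j, 0 ≤ R.coeff j) ∧
      R.natDegree < N := by
  obtain ⟨Q, hQ, hd, hpos, hQr⟩ := exists_dvd_coeff_pos hρ hq hroot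
  set W := (X - C ρ) * Q with hWdef
  have hW : W.Monic := (monic_X_sub_C ρ).mul hQ
  have hWdeg : W.natDegree = Q.natDegree + 1 := by
    rw [hWdef, (monic_X_sub_C ρ).natDegree_mul hQ, natDegree_X_sub_C, add_comm]
  have hlt : ∀ N, (X ^ N %ₘ W).natDegree < W.natDegree := fun N =>
    natDegree_modByMonic_lt (X ^ N) hW (by intro h; simp [h] at hWdeg)
  have hev : ∀ᶠ N in atTop, ∀ j ∈ Finset.range W.natDegree, 0 ≤ (X ^ N %ₘ W).coeff j :=
    (Filter.eventually_all_finset _).2 fun j _ =>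
      eventually_coeff_modByMonic_nonneg hρ hQ hpos hQr j
  obtain ⟨N, hN, hNW⟩ := (hev.and (eventually_ge_atTop W.natDegree)).exists
  refine ⟨N, X ^ N %ₘ W, ?_, fun j => ?_, (hlt N).trans_le hNW⟩
  · refine (mul_dvd_mul_left (X - C ρ) hd).trans ⟨X ^ N /ₘ W, ?_⟩
    linear_combination -modByMonic_add_div (X ^ N) W
  · by_cases hj : j < W.natDegree
    · exact hN j (Finset.mem_range.2 hj)
    · rw [coeff_eq_zero_of_natDegree_lt (lt_of_lt_of_le (hlt N) (not_lt.1 hj))]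

/-- A polynomial whose roots of maximal modulus `ρ` come with the rotational symmetry of an
imprimitive matrix divides some `X ^ N - R` with `R` nonnegative of degree `< N`. With `d` the
greatest common divisor of the degree gaps, `p = X ^ r * g(X ^ d)`, and `ρ ^ d` is the only root
of maximal modulus of `g`. -/
lemma exists_dvd_X_pow_sub_of_rotation {ρ : ℝ} (hρ : 0 < ρ) {p p₂ : ℝ[X]} (hp : p.Monic)
    (hfac : p = (X - C ρ) * p₂) (hp₂ : p₂.eval ρ ≠ 0)
    (hnorm : ∀ z : ℂ, aeval z p = 0 → ‖z‖ ≤ ρ)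
    (hrot : ∀ z : ℂ, aeval z p = 0 → ‖z‖ = ρ → ∀ j, p.coeff j ≠ 0 →
      (z / ρ) ^ (p.natDegree - j) = 1)
    (huniq : ∀ t : ℝ, 0 < t → p.eval t = 0 → t = ρ) :
    ∃ (N : ℕ) (R : ℝ[X]), p ∣ X ^ N - R ∧ (∀ j, 0 ≤ R.coeff j) ∧ R.natDegree < N := by
  have hpρ : p.eval ρ = 0 := by rw [hfac]; simp
  set d := p.support.gcd fun j => p.natDegree - j with hd
  have hdvd : ∀ j, p.coeff j ≠ 0 → d ∣ p.natDegree - j := fun j hj =>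
    Finset.gcd_dvd (mem_support_iff.2 hj)
  -- `d = 0` would mean that `p` is a monomial.
  have hd0 : 0 < d := by
    rw [Nat.pos_iff_ne_zero]
    intro h
    rw [hd, Finset.gcd_eq_zero_iff] at h
    have h1 : p = X ^ p.natDegree := by
      ext j
      rw [coeff_X_pow]
      split_ifs with hj
      · rw [hj, coeff_natDegree, hp.leadingCoeff]
      · by_contra hj'
        have h2 := h j (mem_support_iff.2 hj')
        have h3 := le_natDegree_of_ne_zero hj'
        omega
    rw [h1, eval_pow, eval_X] at hpρ
    exact (pow_pos hρ _).ne' hpρ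
  obtain ⟨q₀, hq₀, hX⟩ := exists_eq_pow_rootMultiplicity_mul_and_not_dvd p hp.ne_zero 0
  rw [C_0, sub_zero] at hq₀ hX
  set r := rootMultiplicity 0 p with hr
  have hq₀m : q₀.Monic := (monic_X_pow r).of_mul_monic_left (hq₀ ▸ hp)
  have hq₀0 : q₀.coeff 0 ≠ 0 := by rwa [Ne, ← X_dvd_iff]
  have hcoef : ∀ j, q₀.coeff j = p.coeff (j + r) := fun j => by
    rw [hq₀, coeff_X_pow_mul]
  have hrdeg : d ∣ p.natDegree - r := hdvd r (by simpa [hcoef] using hq₀0)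
  have hexp : expand ℝ d (contract d q₀) = q₀ := by
    ext j
    rw [coeff_expand hd0]
    split_ifs with hj
    · rw [coeff_contract hd0.ne', Nat.div_mul_cancel hj]
    · by_contra hne
      have h1 : p.coeff (j + r) ≠ 0 := by rw [← hcoef]; exact fun h => hne h.symm
      have h2 := hdvd _ h1
      have h3 := le_natDegree_of_ne_zero h1
      apply hj
      have h4 := (Nat.dvd_sub hrdeg h2)
      rwa [show p.natDegree - r - (p.natDegree - (j + r)) = j by omega] at h4
  set g := contract d q₀ with hg
  have hgm : g.Monic := by rw [← monic_expand_iff hd0, hexp]; exact hq₀m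
  have hpg : p = X ^ r * expand ℝ d g := by rw [hexp]; exact hq₀
  have hgρ : g.eval (ρ ^ d) = 0 := by
    rw [hpg, eval_mul, expand_eval, eval_pow, eval_X, mul_eq_zero] at hpρ
    exact hpρ.resolve_left (pow_pos hρ r).ne'
  obtain ⟨q, hq⟩ := dvd_iff_isRoot.2 hgρ
  have hqm : q.Monic := (monic_X_sub_C _).of_mul_monic_left (hq ▸ hgm)
  -- A double root `ρ ^ d` of `g` would make `ρ` a double root of `p`.
  have hqρ : q.eval (ρ ^ d) ≠ 0 := by
    intro h
    obtain ⟨q', hq'⟩ := dvd_iff_isRoot.2 h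
    obtain ⟨t, ht⟩ : X - C ρ ∣ X ^ d - C ρ ^ d := sub_dvd_pow_sub_pow _ _ _
    have h1 : (X - C ρ) * p₂ = (X - C ρ) * ((X - C ρ) * (X ^ r * t ^ 2 * expand ℝ d q')) := by
      rw [← hfac, hpg, hq, hq', map_mul, map_mul, map_sub, expand_X, expand_C, C_pow, ht]
      ring
    apply hp₂
    rw [mul_left_cancel₀ (X_sub_C_ne_zero ρ) h1]
    simp
  have hroot : ∀ y : ℂ, aeval y q = 0 → ‖y‖ < ρ ^ d ∧ ∀ s : ℝ, 0 ≤ s → y ≠ s := by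
    intro y hy
    have hgy : aeval y g = 0 := by rw [hq, map_mul, hy, mul_zero]
    -- The roots of `g` are the `d`-th powers of the nonzero roots of `p`. A root of modulus
    -- `ρ ^ d`, or a positive one, equals `ρ ^ d`, which is not a root of `q`.
    have hyρ : y ≠ ((ρ ^ d : ℝ) : ℂ) := by
      rintro rfl
      have : aeval ((ρ ^ d : ℝ) : ℂ) q = ((q.eval (ρ ^ d) : ℝ) : ℂ) :=
        aeval_algebraMap_apply_eq_algebraMap_eval (A := ℂ) (ρ ^ d) q
      rw [this] at hy
      exact hqρ (by exact_mod_cast hy)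
    have hroot_of_pow : ∀ x : ℂ, x ^ d = y → aeval x p = 0 := fun x hx => by
      rw [hpg, map_mul, expand_aeval, hx, hgy, mul_zero]
    constructor
    · obtain ⟨x, hx⟩ := IsAlgClosed.exists_pow_nat_eq y hd0
      have hxp := hroot_of_pow x hx
      rw [← hx, norm_pow]
      refine pow_lt_pow_left₀ (lt_of_le_of_ne (hnorm x hxp) fun h => hyρ ?_) (norm_nonneg x)
        hd0.ne'
      have h1 : orderOf (x / ρ) ∣ d :=
        Finset.dvd_gcd fun j hj => orderOf_dvd_of_pow_eq_one
          (hrot x hxp h j (mem_support_iff.1 hj))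
      rw [orderOf_dvd_iff_pow_eq_one, div_pow, div_eq_one_iff_eq] at h1
      · rw [← hx, h1, Complex.ofReal_pow]
      · exact pow_ne_zero _ (by exact_mod_cast hρ.ne')
    · rintro s hs rfl
      have hs0 : s ≠ 0 := by
        rintro rfl
        apply hq₀0
        have h1 : aeval ((0 : ℝ) : ℂ) g = ((g.eval 0 : ℝ) : ℂ) :=
          aeval_algebraMap_apply_eq_algebraMap_eval (A := ℂ) (0 : ℝ) g
        rw [h1] at hgy
        have h2 : g.coeff 0 = 0 := by rw [coeff_zero_eq_eval_zero]; exact_mod_cast hgy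
        rwa [hg, coeff_contract hd0.ne', zero_mul] at h2
      have hspos : 0 < s := lt_of_le_of_ne hs hs0.symm
      have hroots : (s ^ ((d : ℝ)⁻¹)) ^ d = s := Real.rpow_inv_natCast_pow hs hd0.ne'
      have h1 := hroot_of_pow ((s ^ ((d : ℝ)⁻¹) : ℝ) : ℂ) (by rw [← Complex.ofReal_pow, hroots])
      have h2 : aeval ((s ^ ((d : ℝ)⁻¹) : ℝ) : ℂ) p = ((p.eval (s ^ ((d : ℝ)⁻¹)) : ℝ) : ℂ) :=
        aeval_algebraMap_apply_eq_algebraMap_eval (A := ℂ) _ p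
      rw [h2] at h1
      have h3 := huniq _ (Real.rpow_pos_of_pos hspos _) (by exact_mod_cast h1)
      apply hyρ
      rw [← h3, hroots]
  obtain ⟨N, R, ⟨t, ht⟩, hR, hRN⟩ := exists_dvd_X_pow_sub (pow_pos hρ d) hqm hroot
  refine ⟨r + d * N, X ^ r * expand ℝ d R, ⟨expand ℝ d t, ?_⟩, fun j => ?_, ?_⟩
  · rw [← hq] at ht
    have h1 := congrArg (expand ℝ d) ht
    rw [map_sub, map_pow, expand_X, map_mul] at h1
    rw [hpg, pow_add, pow_mul]
    linear_combination X ^ r * h1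
  · rw [coeff_X_pow_mul', coeff_expand hd0]
    split_ifs
    exacts [hR _, le_rfl, le_rfl]
  · refine lt_of_le_of_lt natDegree_mul_le ?_
    rw [natDegree_X_pow, natDegree_expand, mul_comm d N]
    exact Nat.add_lt_add_left (Nat.mul_lt_mul_of_pos_right hRN hd0) r

end Polynomials

/-! ### Perron–Frobenius theory of an irreducible matrix -/

open Matrix

variable {n : ℕ} {A : Matrix (Fin n) (Fin n) ℝ}

lemma pow_mulVec_of_mulVec_eq {x : Fin n → ℝ} {r : ℝ} (h : A *ᵥ x = r • x) (k : ℕ) :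
    (A ^ k) *ᵥ x = r ^ k • x := by
  induction k with
  | zero => simp
  | succ k ih => rw [pow_succ, ← mulVec_mulVec, h, mulVec_smul, ih, smul_smul, pow_succ']

/-- A sum of powers of an irreducible matrix that has positive entries. -/
lemma exists_sum_pow_pos (hA : A.IsIrreducible) :
    ∃ k : Fin n → Fin n → ℕ, ∀ i j, 0 < (∑ a, ∑ b, A ^ k a b) i j := by
  have h := (isIrreducible_iff_exists_pow_pos hA.nonneg).1 hA
  choose k _ hk' using h
  refine ⟨k, fun i j => ?_⟩
  have hnn : ∀ a b, 0 ≤ (A ^ k a b) i j := fun a b => pow_apply_nonneg hA.nonneg _ i j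
  simp only [Matrix.sum_apply]
  exact Finset.sum_pos' (fun a _ => Finset.sum_nonneg fun b _ => hnn a b)
    ⟨i, Finset.mem_univ i, Finset.sum_pos' (fun b _ => hnn i b) ⟨j, Finset.mem_univ j, hk' i j⟩⟩

lemma mulVec_pos {T : Matrix (Fin n) (Fin n) ℝ} (hT : ∀ i j, 0 < T i j) {x : Fin n → ℝ}
    (hx : ∀ i, 0 ≤ x i) (hx0 : x ≠ 0) (i : Fin n) : 0 < (T *ᵥ x) i := by
  obtain ⟨j, hj⟩ := Function.ne_iff.1 hx0
  exact Finset.sum_pos' (fun a _ => mul_nonneg (hT i a).le (hx a))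
    ⟨j, Finset.mem_univ j, mul_pos (hT i j) (lt_of_le_of_ne (hx j) (Ne.symm hj))⟩

lemma pos_of_mulVec_eq (hA : A.IsIrreducible) {x : Fin n → ℝ} (hx : ∀ i, 0 ≤ x i) (hx0 : x ≠ 0)
    {r : ℝ} (h : A *ᵥ x = r • x) (i : Fin n) : 0 < x i := by
  obtain ⟨k, hk⟩ := exists_sum_pow_pos hA
  have h1 := mulVec_pos hk hx hx0 i
  have h2 : (∑ a, ∑ b, A ^ k a b) *ᵥ x = (∑ a, ∑ b, r ^ k a b) • x := by
    simp only [Matrix.sum_mulVec, Finset.sum_smul, pow_mulVec_of_mulVec_eq h]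
  rw [h2, Pi.smul_apply, smul_eq_mul] at h1
  exact lt_of_le_of_ne (hx i) fun h => by simp [← h] at h1

/-- Existence of a positive eigenvector: the largest `r` with `r x ≤ A x` for some `x` in the
simplex is attained, and then equality holds. -/
lemma exists_pos_eigenvector (hn : 1 ≤ n) (hA : A.IsIrreducible) :
    ∃ (r : ℝ) (x : Fin n → ℝ), 0 < r ∧ (∀ i, 0 < x i) ∧ A *ᵥ x = r • x := by
  have i₀ : Fin n := ⟨0, hn⟩
  have hA0 := hA.nonneg
  set B : ℝ := ∑ i, ∑ j, A i j with hB
  have hB0 : 0 ≤ B := Finset.sum_nonneg fun i _ => Finset.sum_nonneg fun j _ => hA0 i j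
  let K : Set (ℝ × (Fin n → ℝ)) :=
    (Set.Icc 0 B ×ˢ stdSimplex ℝ (Fin n)) ∩ {p | ∀ i, p.1 * p.2 i ≤ (A *ᵥ p.2) i}
  have hbound : ∀ (r : ℝ) (x : Fin n → ℝ), x ∈ stdSimplex ℝ (Fin n) →
      (∀ i, r * x i ≤ (A *ᵥ x) i) → r ≤ B := by
    intro r x hx h
    have h1 : ∑ i, r * x i ≤ ∑ i, (A *ᵥ x) i := Finset.sum_le_sum fun i _ => h i
    rw [← Finset.mul_sum, hx.2, mul_one] at h1
    refine h1.trans (Finset.sum_le_sum fun i _ => ?_)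
    rw [mulVec_apply]
    refine Finset.sum_le_sum fun j _ => ?_
    exact mul_le_of_le_one_right (hA0 i j)
      (hx.2 ▸ Finset.single_le_sum (fun a _ => hx.1 a) (Finset.mem_univ j))
  have hKc : IsCompact K := by
    refine (isCompact_Icc.prod (isCompact_stdSimplex ℝ (Fin n))).inter_right ?_
    simp only [Set.ofPred_forall]
    refine isClosed_iInter fun i => isClosed_le (by fun_prop) ?_
    exact (continuous_apply i).comp (Continuous.matrix_mulVec continuous_const continuous_snd)
  have hKne : K.Nonempty := by
    refine ⟨(0, Pi.single i₀ 1), ⟨⟨⟨le_rfl, hB0⟩, single_mem_stdSimplex ℝ i₀⟩, fun i => ?_⟩⟩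
    rw [zero_mul, mulVec_apply]
    refine Finset.sum_nonneg fun j _ => mul_nonneg (hA0 i j) ?_
    exact (single_mem_stdSimplex ℝ i₀).1 j
  obtain ⟨⟨r, x⟩, ⟨⟨hr, hx⟩, hrx⟩, hmax⟩ := hKc.exists_isMaxOn hKne continuous_fst.continuousOn
  simp only [Set.mem_ofPred_eq] at hrx hr hx
  have hx0 : x ≠ 0 := by
    rintro rfl
    simpa using hx.2
  have heq : A *ᵥ x = r • x := by
    by_contra hne
    obtain ⟨k, hk⟩ := exists_sum_pow_pos hA
    set T := ∑ a, ∑ b, A ^ k a b with hT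
    have hcomm : A * T = T * A := by
      have : Commute A T := Commute.sum_right _ _ _ fun a _ =>
        Commute.sum_right _ _ _ fun b _ => Commute.pow_right (Commute.refl A) _
      exact this
    -- `T` makes the nonnegative nonzero vector `A x - r x` positive, so `T x`, after normalization,
    -- allows a larger value of `r`.
    have hy := mulVec_pos hk (x := A *ᵥ x - r • x) (fun i => sub_nonneg.2 (hrx i))
      (sub_ne_zero.2 hne)
    have hz := mulVec_pos hk hx.1 hx0
    have hTy : T *ᵥ (A *ᵥ x - r • x) = A *ᵥ (T *ᵥ x) - r • (T *ᵥ x) := by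
      rw [mulVec_sub, mulVec_mulVec, ← hcomm, ← mulVec_mulVec, mulVec_smul]
    obtain ⟨i₁, _, hi₁⟩ := Finset.exists_min_image Finset.univ
      (fun i => (T *ᵥ (A *ᵥ x - r • x)) i / (T *ᵥ x) i) ⟨i₀, Finset.mem_univ i₀⟩
    set ε := (T *ᵥ (A *ᵥ x - r • x)) i₁ / (T *ᵥ x) i₁ with hε
    have hε0 : 0 < ε := div_pos (hy i₁) (hz i₁)
    have hle : ∀ i, (r + ε) * (T *ᵥ x) i ≤ (A *ᵥ (T *ᵥ x)) i := by
      intro i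
      have h1 := hi₁ i (Finset.mem_univ i)
      rw [le_div_iff₀ (hz i), hTy] at h1
      simp only [Pi.sub_apply, Pi.smul_apply, smul_eq_mul] at h1
      linarith
    set σ := ∑ i, (T *ᵥ x) i with hσ
    have hσ0 : 0 < σ := Finset.sum_pos (fun i _ => hz i) ⟨i₀, Finset.mem_univ i₀⟩
    have hmem : σ⁻¹ • (T *ᵥ x) ∈ stdSimplex ℝ (Fin n) := by
      refine ⟨fun i => mul_nonneg (inv_pos.2 hσ0).le (hz i).le, ?_⟩
      simp only [Pi.smul_apply, smul_eq_mul]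
      rw [← Finset.mul_sum, inv_mul_cancel₀ hσ0.ne']
    have hle' : ∀ i, (r + ε) * (σ⁻¹ • (T *ᵥ x)) i ≤ (A *ᵥ (σ⁻¹ • (T *ᵥ x))) i := by
      intro i
      rw [mulVec_smul, Pi.smul_apply, Pi.smul_apply, smul_eq_mul, smul_eq_mul, mul_left_comm]
      exact mul_le_mul_of_nonneg_left (hle i) (inv_pos.2 hσ0).le
    have h3 : r + ε ≤ r := hmax (a := (r + ε, σ⁻¹ • (T *ᵥ x)))
      ⟨⟨⟨by linarith [hr.1], hbound _ _ hmem hle'⟩, hmem⟩, hle'⟩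
    linarith
  have hpos := pos_of_mulVec_eq hA hx.1 hx0 heq
  refine ⟨r, x, lt_of_le_of_ne hr.1 ?_, hpos, heq⟩
  -- `r ≠ 0`: otherwise `A ^ k x = 0` for `k > 0`, though some such power has a positive diagonal
  -- entry.
  rintro rfl
  obtain ⟨k, hk, hk'⟩ := (isIrreducible_iff_exists_pow_pos hA0).1 hA i₀ i₀
  have h1 := congrFun (pow_mulVec_of_mulVec_eq heq k) i₀
  rw [zero_pow hk.ne', zero_smul, Pi.zero_apply] at h1
  have h2 : 0 < ((A ^ k) *ᵥ x) i₀ := Finset.sum_pos'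
    (fun j _ => mul_nonneg (pow_apply_nonneg hA0 k i₀ j) (hpos j).le)
    ⟨i₀, Finset.mem_univ _, mul_pos hk' (hpos i₀)⟩
  exact h2.ne' h1

/-- A positive number `r` together with positive right and left eigenvectors `v`, `u` of `A`. -/
structure IsPerronTriple (A : Matrix (Fin n) (Fin n) ℝ) (r : ℝ) (v u : Fin n → ℝ) : Prop where
  pos : 0 < r
  right_pos : ∀ i, 0 < v i
  left_pos : ∀ i, 0 < u i
  right : A *ᵥ v = r • v
  left : u ᵥ* A = r • u

lemma exists_isPerronTriple (hn : 1 ≤ n) (hA : A.IsIrreducible) :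
    ∃ r v u, IsPerronTriple A r v u := by
  obtain ⟨r, v, hr, hv, hrv⟩ := exists_pos_eigenvector hn hA
  obtain ⟨s, u, hs, hu, hsu⟩ := exists_pos_eigenvector hn hA.transpose
  rw [mulVec_transpose] at hsu
  have h0 : 0 < u ⬝ᵥ v := Finset.sum_pos (fun i _ => mul_pos (hu i) (hv i))
    ⟨⟨0, hn⟩, Finset.mem_univ _⟩
  have h1 : u ⬝ᵥ (A *ᵥ v) = (u ᵥ* A) ⬝ᵥ v := dotProduct_mulVec u A v
  rw [hrv, hsu, dotProduct_smul, smul_dotProduct, smul_eq_mul, smul_eq_mul] at h1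
  obtain rfl : r = s := mul_right_cancel₀ h0.ne' h1
  exact ⟨r, v, u, hr, hv, hu, hrv, hsu⟩

variable {r : ℝ} {v u : Fin n → ℝ}

lemma IsPerronTriple.dotProduct_mulVec (h : IsPerronTriple A r v u) (x : Fin n → ℝ) :
    u ⬝ᵥ (A *ᵥ x) = r * (u ⬝ᵥ x) := by
  rw [Matrix.dotProduct_mulVec, h.left, smul_dotProduct, smul_eq_mul]

lemma dotProduct_pos_of_nonneg (hu : ∀ i, 0 < u i) {x : Fin n → ℝ} (hx : ∀ i, 0 ≤ x i)
    (hx0 : x ≠ 0) : 0 < u ⬝ᵥ x := by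
  obtain ⟨j, hj⟩ := Function.ne_iff.1 hx0
  exact Finset.sum_pos' (fun a _ => mul_nonneg (hu a).le (hx a))
    ⟨j, Finset.mem_univ j, mul_pos (hu j) (lt_of_le_of_ne (hx j) (Ne.symm hj))⟩

lemma IsPerronTriple.le_of_smul_le (h : IsPerronTriple A r v u) {x : Fin n → ℝ}
    (hx : ∀ i, 0 ≤ x i) (hx0 : x ≠ 0) {s : ℝ} (hs : ∀ i, s * x i ≤ (A *ᵥ x) i) : s ≤ r := by
  have h1 : u ⬝ᵥ (s • x) ≤ u ⬝ᵥ (A *ᵥ x) :=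
    Finset.sum_le_sum fun i _ => mul_le_mul_of_nonneg_left (hs i) (h.left_pos i).le
  rw [h.dotProduct_mulVec, dotProduct_smul, smul_eq_mul] at h1
  exact le_of_mul_le_mul_right h1 (dotProduct_pos_of_nonneg h.left_pos hx hx0)

lemma IsPerronTriple.mulVec_eq_of_le (h : IsPerronTriple A r v u) {x : Fin n → ℝ}
    (hs : ∀ i, r * x i ≤ (A *ᵥ x) i) : A *ᵥ x = r • x := by
  by_contra hne
  have h1 := dotProduct_pos_of_nonneg h.left_pos (x := A *ᵥ x - r • x)
    (fun i => sub_nonneg.2 (hs i)) (sub_ne_zero.2 hne)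
  rw [dotProduct_sub, h.dotProduct_mulVec, dotProduct_smul, smul_eq_mul, sub_self] at h1
  exact lt_irrefl _ h1

/-- The Perron eigenvalue is geometrically simple. -/
lemma IsPerronTriple.eq_smul (h : IsPerronTriple A r v u) (hn : 1 ≤ n) (hA : A.IsIrreducible)
    {x : Fin n → ℝ} (hx : A *ᵥ x = r • x) : ∃ c : ℝ, x = c • v := by
  -- Subtracting the largest multiple of `v` below `x` leaves a nonnegative eigenvector with a zero
  -- entry, which has to vanish.
  obtain ⟨i₁, _, hi₁⟩ := Finset.exists_min_image Finset.univ (fun i => x i / v i)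
    ⟨(⟨0, hn⟩ : Fin n), Finset.mem_univ _⟩
  refine ⟨x i₁ / v i₁, ?_⟩
  by_contra hne
  have h1 := pos_of_mulVec_eq hA (x := x - (x i₁ / v i₁) • v) (r := r) (fun i => ?_)
    (sub_ne_zero.2 hne) ?_ i₁
  · simp only [Pi.sub_apply, Pi.smul_apply, smul_eq_mul, div_mul_cancel₀ _ (h.right_pos i₁).ne',
      sub_self, lt_irrefl] at h1
  · have := hi₁ i (Finset.mem_univ i)
    rw [le_div_iff₀ (h.right_pos i)] at this
    exact sub_nonneg.2 this
  · rw [mulVec_sub, mulVec_smul, hx, h.right, smul_sub, smul_comm r]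

lemma mem_spec_iff {m : ℕ} {M : Matrix (Fin m) (Fin m) ℝ} {z : ℂ} :
    z ∈ spec M ↔ aeval z M.charpoly = 0 := by
  have h1 : (M.map (fun r : ℝ => (r : ℂ))).charpoly = M.charpoly.map (algebraMap ℝ ℂ) :=
    charpoly_map M (algebraMap ℝ ℂ)
  rw [spec, mem_spectrum_iff_isRoot_charpoly, h1, IsRoot, eval_map, aeval_def]

lemma exists_eigenvector_of_mem_spec {z : ℂ} (hz : z ∈ spec A) :
    ∃ w : Fin n → ℂ, w ≠ 0 ∧ ∀ i, ∑ j, (A i j : ℂ) * w j = z * w i := by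
  rw [spec, mem_spectrum_iff_isRoot_charpoly, IsRoot, eval_charpoly,
    ← exists_mulVec_eq_zero_iff] at hz
  obtain ⟨w, hw, hw'⟩ := hz
  refine ⟨w, hw, fun i => ?_⟩
  rw [sub_mulVec, sub_eq_zero] at hw'
  have h1 := congrFun hw' i
  rw [scalar_apply, mulVec_diagonal] at h1
  exact h1.symm

lemma norm_mul_le_mulVec (hA : ∀ i j, 0 ≤ A i j) {z : ℂ} {w : Fin n → ℂ}
    (hw : ∀ i, ∑ j, (A i j : ℂ) * w j = z * w i) (i : Fin n) :
    ‖z‖ * ‖w i‖ ≤ (A *ᵥ fun j => ‖w j‖) i := by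
  rw [← norm_mul, ← hw i]
  refine (norm_sum_le _ _).trans (le_of_eq (Finset.sum_congr rfl fun j _ => ?_))
  rw [norm_mul, Complex.norm_real, Real.norm_of_nonneg (hA i j)]

lemma IsPerronTriple.norm_le (h : IsPerronTriple A r v u) (hA : A.IsIrreducible) {z : ℂ}
    (hz : z ∈ spec A) : ‖z‖ ≤ r := by
  obtain ⟨w, hw, hw'⟩ := exists_eigenvector_of_mem_spec hz
  refine h.le_of_smul_le (fun i => norm_nonneg (w i)) (fun h0 => hw ?_)
    (norm_mul_le_mulVec hA.nonneg hw')
  ext i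
  simpa using congrFun h0 i

lemma IsPerronTriple.mem_spec (h : IsPerronTriple A r v u) (hn : 1 ≤ n) : (r : ℂ) ∈ spec A := by
  have h1 : aeval (r : ℂ) A.charpoly = ((A.charpoly.eval r : ℝ) : ℂ) :=
    aeval_algebraMap_apply_eq_algebraMap_eval (A := ℂ) r A.charpoly
  rw [mem_spec_iff, h1, eval_charpoly, exists_mulVec_eq_zero_iff.1 ⟨v, ?_, ?_⟩, Complex.ofReal_zero]
  · exact fun h0 => (h.right_pos ⟨0, hn⟩).ne' (congrFun h0 _)
  · rw [sub_mulVec, h.right, sub_eq_zero]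
    ext i
    rw [scalar_apply, mulVec_diagonal]
    rfl

lemma IsPerronTriple.rho_eq (h : IsPerronTriple A r v u) (hn : 1 ≤ n) (hA : A.IsIrreducible) :
    rho A = r := by
  have h1 : spectralRadius ℂ (A.map (fun r : ℝ => (r : ℂ))) = ENNReal.ofReal r := by
    refine le_antisymm (iSup₂_le fun z hz => ?_) ?_
    · change ‖z‖ₑ ≤ _
      rw [← ofReal_norm]
      exact ENNReal.ofReal_le_ofReal (h.norm_le hA hz)
    · refine le_trans (le_of_eq ?_) (le_iSup₂ (f := fun z (_ : z ∈ spec A) => (‖z‖₊ : ENNReal))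
        (r : ℂ) (h.mem_spec hn))
      change _ = ‖(r : ℂ)‖ₑ
      rw [← ofReal_norm, Complex.norm_real, Real.norm_of_nonneg h.pos.le]
  rw [rho, h1, ENNReal.toReal_ofReal h.pos.le]

/-- Equality in the triangle inequality forces all terms onto one ray. -/
lemma eq_norm_mul_of_norm_sum_eq {ι : Type*} [Fintype ι] {f : ι → ℂ} {s : ℂ} (hs : ‖s‖ = 1)
    (h : ∑ j, f j = (∑ j, ‖f j‖ : ℝ) * s) (j : ι) : f j = ‖f j‖ * s := by
  have hss : s * (starRingEnd ℂ) s = 1 := by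
    rw [Complex.mul_conj', hs]; simp
  have h1 : ∑ j, (f j * (starRingEnd ℂ) s).re = ∑ j, ‖f j * (starRingEnd ℂ) s‖ := by
    rw [← Complex.re_sum, ← Finset.sum_mul, h, mul_assoc, hss, mul_one, Complex.ofReal_re]
    simp [hs]
  have h2 := (Finset.sum_eq_sum_iff_of_le fun j _ => Complex.re_le_norm _).1 h1 j
    (Finset.mem_univ j)
  have h3 : f j * (starRingEnd ℂ) s = (‖f j‖ : ℂ) := by
    have h4 := (Complex.nonneg_iff.1 (Complex.re_eq_norm.1 h2))
    rw [norm_mul, Complex.norm_conj, hs, mul_one] at h2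
    exact Complex.ext (by simpa using h2) (by simpa using h4.2.symm)
  rw [← h3, mul_assoc, mul_comm _ s, hss, mul_one]

/-- Rotational symmetry of the spectrum: a peripheral eigenvector `w` gives the unitary diagonal
matrix `D = diag(w i / ‖w i‖)` with `A D = (z / r) D A`, so the characteristic polynomial `p`
satisfies `p((z / r) t) = (z / r) ^ n p(t)`. -/
lemma IsPerronTriple.pow_eq_one_of_coeff_ne_zero (h : IsPerronTriple A r v u)
    (hA : A.IsIrreducible) {z : ℂ} (hz : z ∈ spec A) (hzr : ‖z‖ = r) {k : ℕ}
    (hk : A.charpoly.coeff k ≠ 0) : (z / r) ^ (n - k) = 1 := by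
  obtain ⟨w, hw, hw'⟩ := exists_eigenvector_of_mem_spec hz
  have hr0 : (r : ℂ) ≠ 0 := by exact_mod_cast h.pos.ne'
  have hAx := h.mulVec_eq_of_le (x := fun i => ‖w i‖)
    (by simpa only [hzr] using norm_mul_le_mulVec hA.nonneg hw')
  have hx0 : (fun i => ‖w i‖) ≠ 0 := fun h0 => hw (by ext i; simpa using congrFun h0 i)
  have hpos : ∀ i, 0 < ‖w i‖ := pos_of_mulVec_eq hA (fun i => norm_nonneg _) hx0 hAx
  have hw0 : ∀ i, (‖w i‖ : ℂ) ≠ 0 := fun i => by exact_mod_cast (hpos i).ne'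
  set ω : ℂ := z / r with hω
  have hωn : ‖ω‖ = 1 := by
    rw [hω, norm_div, hzr, Complex.norm_real, Real.norm_of_nonneg h.pos.le, div_self h.pos.ne']
  have hω0 : ω ≠ 0 := by intro h0; simp [h0] at hωn
  set D : Fin n → ℂ := fun i => w i / ‖w i‖ with hD
  have hDn : ∀ i, ‖D i‖ = 1 := fun i => by
    simp [hD, (hpos i).ne']
  have hAD : ∀ i j, (A i j : ℂ) * D j = ω * D i * A i j := by
    intro i j
    have hn1 : ∀ j, ‖(A i j : ℂ) * w j‖ = A i j * ‖w j‖ := fun j => by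
      rw [norm_mul, Complex.norm_real, Real.norm_of_nonneg (hA.nonneg i j)]
    have h1 : ∑ j, (A i j : ℂ) * w j = (∑ j, ‖(A i j : ℂ) * w j‖ : ℝ) * (ω * D i) := by
      have h2 : ∑ j, ‖(A i j : ℂ) * w j‖ = r * ‖w i‖ := by
        simp only [hn1]
        exact congrFun hAx i
      rw [h2, hw' i, hω, hD]
      push_cast
      field_simp [hw0 i]
    have h3 := eq_norm_mul_of_norm_sum_eq (by rw [norm_mul, hωn, hDn, one_mul]) h1 j
    rw [hn1] at h3
    push_cast at h3
    change (A i j : ℂ) * (w j / ‖w j‖) = _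
    rw [mul_div_assoc', h3, div_eq_iff (hw0 j)]
    ring
  set p := (A.map (fun r : ℝ => (r : ℂ))).charpoly with hp
  have hpc : p = A.charpoly.map (algebraMap ℝ ℂ) := charpoly_map A (algebraMap ℝ ℂ)
  have hdet : ∀ t : ℂ, p.eval (ω * t) = ω ^ n * p.eval t := by
    intro t
    have h1 : (scalar (Fin n) (ω * t) - A.map (fun r : ℝ => (r : ℂ))) * diagonal D
        = ω • (diagonal D * (scalar (Fin n) t - A.map (fun r : ℝ => (r : ℂ)))) := by
      ext i j
      rw [mul_diagonal, Matrix.smul_apply, diagonal_mul, Matrix.sub_apply, Matrix.sub_apply,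
        Matrix.map_apply, sub_mul, hAD i j, scalar_apply, scalar_apply, smul_eq_mul]
      by_cases hij : i = j
      · subst hij; simp only [diagonal_apply_eq]; ring
      · simp only [diagonal_apply_ne _ hij]; ring
    have h2 := congrArg det h1
    rw [det_mul, det_smul, det_mul, det_diagonal, Fintype.card_fin] at h2
    have h3 : ∏ i, D i ≠ 0 := Finset.prod_ne_zero_iff.2 fun i _ h0 => by
      have := hDn i
      simp [h0] at this
    rw [hp, eval_charpoly, eval_charpoly]
    apply mul_right_cancel₀ h3
    rw [h2]; ring
  have hcomp : p.comp (C ω * X) = C (ω ^ n) * p := by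
    refine Polynomial.funext fun t => ?_
    rw [eval_comp, eval_mul, eval_C, eval_X, hdet, eval_mul, eval_C]
  have h4 := congrArg (fun q => q.coeff k) hcomp
  simp only [comp_C_mul_X_coeff, coeff_C_mul] at h4
  have h5 : p.coeff k ≠ 0 := by
    rw [hpc, coeff_map]
    simpa using hk
  rw [mul_comm] at h4
  have h6 := mul_right_cancel₀ h5 h4
  have hkn : k ≤ n := by
    have := le_natDegree_of_ne_zero hk
    rwa [charpoly_natDegree_eq_dim, Fintype.card_fin] at this
  have h7 : ω ^ k * ω ^ (n - k) = ω ^ k * 1 := by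
    rw [← pow_add, Nat.add_sub_cancel' hkn, mul_one, h6]
  exact mul_left_cancel₀ (pow_ne_zero k hω0) h7

/-- The splitting `ℝⁿ = ℝ v ⊕ uᗮ` into `A`-invariant subspaces. -/
lemma IsPerronTriple.exists_splitting (h : IsPerronTriple A r v u) (hn : 1 ≤ n)
    (hA : A.IsIrreducible) :
    ∃ (S : Matrix (Fin n) (Fin 1 ⊕ Fin (n - 1)) ℝ) (T : Matrix (Fin 1 ⊕ Fin (n - 1)) (Fin n) ℝ)
      (A₂ : Matrix (Fin (n - 1)) (Fin (n - 1)) ℝ), S * T = 1 ∧ T * S = 1 ∧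
      A = S * Matrix.fromBlocks (Matrix.of fun (_ _ : Fin 1) => r) 0 0 A₂ * T ∧
      A.charpoly = (X - C r) * A₂.charpoly ∧ A₂.charpoly.eval r ≠ 0 := by
  let f : Module.Dual ℝ (Fin n → ℝ) := dotProductBilin ℝ ℝ u
  have hf : ∀ x, f x = u ⬝ᵥ x := fun x => rfl
  have hv0 : v ≠ 0 := fun h0 => (h.right_pos ⟨0, hn⟩).ne' (congrFun h0 _)
  have hfv : f v ≠ 0 := (dotProduct_pos_of_nonneg h.left_pos (fun i => (h.right_pos i).le) hv0).ne'
  have hf0 : f ≠ 0 := by rintro h0; simp [h0] at hfv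
  have hfin : Module.finrank ℝ (LinearMap.ker f) = n - 1 := by
    have := Module.Dual.finrank_ker_add_one_of_ne_zero hf0
    rw [Module.finrank_fin_fun] at this
    omega
  let β := Module.finBasisOfFinrankEq ℝ (LinearMap.ker f) hfin
  have hβ : ∀ j, f (β j) = 0 := fun j => (β j).2
  have hli : LinearIndependent ℝ
      (Sum.elim (fun _ : Fin 1 => v) fun j => (β j : Fin n → ℝ)) := by
    rw [Fintype.linearIndependent_iff]
    intro g hg
    simp only [Fintype.sum_sum_type, Sum.elim_inl, Sum.elim_inr, Fin.sum_univ_one] at hg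
    have h1 := congrArg f hg
    simp only [map_add, map_smul, map_sum, hβ, mul_zero, Finset.sum_const_zero, add_zero,
      map_zero, smul_eq_mul, mul_eq_zero, hfv, or_false] at h1
    rw [h1, zero_smul, zero_add] at hg
    have h2 : ∑ j, g (Sum.inr j) • β j = 0 := by
      apply Subtype.ext
      simpa using hg
    have h3 := Fintype.linearIndependent_iff.1 β.linearIndependent _ h2
    rintro (i | j)
    · rw [Subsingleton.elim i 0]; exact h1
    · exact h3 j
  let B : Module.Basis (Fin 1 ⊕ Fin (n - 1)) ℝ (Fin n → ℝ) :=
    basisOfLinearIndependentOfCardEqFinrank hli (by simp; omega)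
  have hBl : ∀ i, B (Sum.inl i) = v := fun i => by simp [B]
  have hBr : ∀ j, B (Sum.inr j) = β j := fun j => by simp [B]
  have hrepr : ∀ x, f x = B.repr x (Sum.inl 0) * f v := by
    intro x
    conv_lhs => rw [← B.sum_repr x]
    simp only [Fintype.sum_sum_type, hBl, hBr, Fin.sum_univ_one, map_add, map_smul, map_sum, hβ,
      mul_zero, Finset.sum_const_zero, add_zero, smul_eq_mul]
  set A₂ : Matrix (Fin (n - 1)) (Fin (n - 1)) ℝ :=
    Matrix.of fun i j => B.repr (A *ᵥ B (Sum.inr j)) (Sum.inr i) with hA₂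
  have hM : LinearMap.toMatrix B B (toLin' A)
      = fromBlocks (Matrix.of fun (_ _ : Fin 1) => r) 0 0 A₂ := by
    ext i j
    rw [LinearMap.toMatrix_apply, toLin'_apply]
    rcases j with j | j
    · rw [hBl, h.right, map_smul]
      have h1 : B.repr v = Finsupp.single (Sum.inl 0) 1 := by rw [← hBl 0, B.repr_self]
      rw [h1]
      rcases i with i | i
      · simp [Subsingleton.elim i 0]
      · simp
    · rcases i with i | i
      · have h1 := hrepr (A *ᵥ B (Sum.inr j))
        rw [hf, h.dotProduct_mulVec, ← hf, hBr, hβ, mul_zero] at h1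
        rw [hBr, Subsingleton.elim i 0]
        simpa [hfv] using h1.symm
      · simp [hA₂]
  have hchar : A.charpoly = (X - C r) * A₂.charpoly := by
    rw [← charpoly_toLin', ← LinearMap.charpoly_toMatrix (toLin' A) B, hM,
      charpoly_fromBlocks_zero₁₂]
    congr 1
    rw [charpoly, det_fin_one, charmatrix_apply_eq, of_apply]
  refine ⟨(Pi.basisFun ℝ (Fin n)).toMatrix B, B.toMatrix (Pi.basisFun ℝ (Fin n)), A₂,
    Module.Basis.toMatrix_mul_toMatrix_flip _ _, Module.Basis.toMatrix_mul_toMatrix_flip _ _, ?_,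
    hchar, ?_⟩
  · rw [← hM, basis_toMatrix_mul_linearMap_toMatrix_mul_basis_toMatrix,
      LinearMap.toMatrix_eq_toMatrix', LinearMap.toMatrix'_toLin']
  -- An eigenvector of `A₂` for `r` gives one of `A` in the kernel of `f`; but it is a multiple of
  -- `v`, and `f v ≠ 0`.
  · rw [eval_charpoly, Ne, ← exists_mulVec_eq_zero_iff]
    rintro ⟨w, hw0, hw⟩
    have hw' : A₂ *ᵥ w = r • w := by
      rw [sub_mulVec, sub_eq_zero] at hw
      rw [← hw]
      ext i
      rw [scalar_apply, mulVec_diagonal]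
      rfl
    let x : Fin n → ℝ := B.equivFun.symm (Sum.elim (0 : Fin 1 → ℝ) w)
    have hx : B.equivFun x = Sum.elim (0 : Fin 1 → ℝ) w := B.equivFun.apply_symm_apply _
    have hAx : A *ᵥ x = r • x := by
      apply B.equivFun.injective
      have h1 := LinearMap.toMatrix_mulVec_repr B B (toLin' A) x
      rw [hM, toLin'_apply] at h1
      have h2 : (⇑(B.repr x) : Fin 1 ⊕ Fin (n - 1) → ℝ) = Sum.elim (0 : Fin 1 → ℝ) w := hx
      rw [h2, fromBlocks_mulVec] at h1
      rw [map_smul, hx]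
      change (⇑(B.repr (A *ᵥ x)) : Fin 1 ⊕ Fin (n - 1) → ℝ) = _
      rw [← h1]
      ext (i | i)
      · simp
      · simp [hw']
    obtain ⟨c, hc⟩ := h.eq_smul hn hA hAx
    have hfx : f x = 0 := by
      rw [hrepr]
      have : B.repr x (Sum.inl 0) = 0 := congrFun hx (Sum.inl 0)
      rw [this, zero_mul]
    rw [hc, map_smul, smul_eq_mul, mul_eq_zero, or_iff_left hfv] at hfx
    rw [hfx, zero_smul] at hc
    apply hw0
    ext i
    have := congrFun hx (Sum.inr i)
    simpa [hc] using this.symm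

lemma aeval_ofReal_eq_zero_iff {p : ℝ[X]} {t : ℝ} : aeval (t : ℂ) p = 0 ↔ p.eval t = 0 := by
  have h1 : aeval (t : ℂ) p = ((p.eval t : ℝ) : ℂ) :=
    aeval_algebraMap_apply_eq_algebraMap_eval (A := ℂ) t p
  rw [h1, Complex.ofReal_eq_zero]

lemma hasEigenvalue_toLin'_iff {m : ℕ} {M : Matrix (Fin m) (Fin m) ℝ} {t : ℝ} :
    Module.End.HasEigenvalue (toLin' M) t ↔ (t : ℂ) ∈ spec M := by
  rw [mem_spec_iff, Module.End.hasEigenvalue_iff_isRoot_charpoly, charpoly_toLin',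
    aeval_ofReal_eq_zero_iff, IsRoot]

lemma IsPerronTriple.exists_isPerronDecomposition (h : IsPerronTriple A r v u) (hn : 1 ≤ n)
    (hA : A.IsIrreducible) : ∃ S T A₂, IsPerronDecomposition A S T A₂ := by
  obtain ⟨S, T, A₂, hST, hTS, hAS, hchar, hne⟩ := h.exists_splitting hn hA
  have hrho := h.rho_eq hn hA
  refine ⟨S, T, A₂, hST, hTS, by rw [hrho]; exact hAS, ?_⟩
  ext z
  rw [Set.mem_sdiff, Set.mem_singleton_iff, mem_spec_iff, mem_spec_iff, hchar, hrho, map_mul,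
    mul_eq_zero, map_sub, aeval_X, aeval_C, Complex.coe_algebraMap, sub_eq_zero]
  constructor
  · intro hz
    refine ⟨Or.inr hz, ?_⟩
    rintro rfl
    exact hne (aeval_ofReal_eq_zero_iff.1 hz)
  · rintro ⟨h1, h2⟩
    exact h1.resolve_left h2

/-! ### Nonnegative recursions and the positive spectrum -/

/-- A polynomial `X ^ N - ∑ c i X ^ i` with `c i ≥ 0` has at most one positive root. -/
lemma eq_of_pow_eq_sum {N : ℕ} {c : Fin N → ℝ} (hc : ∀ i, 0 ≤ c i) {s t : ℝ} (hs : 0 < s)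
    (ht : 0 < t) (hs' : s ^ N = ∑ i, c i * s ^ (i : ℕ)) (ht' : t ^ N = ∑ i, c i * t ^ (i : ℕ)) :
    s = t := by
  wlog hst : s ≤ t generalizing s t
  · exact (this ht hs ht' hs' (not_le.1 hst).le).symm
  by_contra hne
  have hlt : s < t := lt_of_le_of_ne hst hne
  have key : ∀ i : Fin N, t ^ (i : ℕ) * s ^ N < s ^ (i : ℕ) * t ^ N := by
    intro i
    have h1 : s ^ (N - i) < t ^ (N - i) := pow_lt_pow_left₀ hlt hs.le (by omega)
    have h2 : (i : ℕ) + (N - i) = N := by omega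
    calc t ^ (i : ℕ) * s ^ N = (t ^ (i : ℕ) * s ^ (i : ℕ)) * s ^ (N - i) := by
          rw [mul_assoc, ← pow_add, h2]
      _ < (t ^ (i : ℕ) * s ^ (i : ℕ)) * t ^ (N - i) := by gcongr
      _ = s ^ (i : ℕ) * t ^ N := by
          rw [mul_comm (t ^ (i : ℕ)), mul_assoc, ← pow_add, h2]
  have hex : ∃ i, 0 < c i := by
    by_contra! h0
    have : ∀ i, c i = 0 := fun i => le_antisymm (h0 i) (hc i)
    simp only [this, zero_mul, Finset.sum_const_zero] at hs'
    exact (pow_pos hs N).ne' hs'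
  obtain ⟨i, hi⟩ := hex
  have h3 : ∑ i, c i * (t ^ (i : ℕ) * s ^ N) < ∑ i, c i * (s ^ (i : ℕ) * t ^ N) :=
    Finset.sum_lt_sum (fun j _ => mul_le_mul_of_nonneg_left (key j).le (hc j))
      ⟨i, Finset.mem_univ i, mul_lt_mul_of_pos_left (key i) hi⟩
  simp only [← mul_assoc, ← Finset.sum_mul] at h3
  rw [← hs', ← ht', mul_comm] at h3
  exact lt_irrefl _ h3

lemma pow_eq_sum_of_mem_spec {N : ℕ} {c : Fin N → ℝ} (hc : A ^ N = ∑ i, c i • A ^ (i : ℕ))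
    {s : ℝ} (hs : (s : ℂ) ∈ spec A) : s ^ N = ∑ i, c i * s ^ (i : ℕ) := by
  obtain ⟨x, hx⟩ := (hasEigenvalue_toLin'_iff.2 hs).exists_hasEigenvector
  have hAx : A *ᵥ x = s • x := by simpa using hx.apply_eq_smul
  have h1 := congrArg (fun M => M *ᵥ x) hc
  simp only [Matrix.sum_mulVec, smul_mulVec, pow_mulVec_of_mulVec_eq hAx, smul_smul,
    ← Finset.sum_smul] at h1
  exact smul_left_injective ℝ hx.2 h1

lemma HasNonnegRecursion.of_charpoly_dvd {N : ℕ} {R : ℝ[X]} (hd : A.charpoly ∣ X ^ N - R)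
    (hR : ∀ j, 0 ≤ R.coeff j) (hRN : R.natDegree < N) : HasNonnegRecursion A := by
  refine ⟨N, fun i => R.coeff i, fun i => hR i, ?_⟩
  obtain ⟨q, hq⟩ := hd
  have h1 := congrArg (aeval A) hq
  rw [map_mul, aeval_self_charpoly, zero_mul, map_sub, map_pow, aeval_X, sub_eq_zero,
    aeval_eq_sum_range' hRN] at h1
  rw [h1, Finset.sum_range]

theorem IsPerronTriple.hasNonnegRecursion_iff (h : IsPerronTriple A r v u) (hn : 1 ≤ n)
    (hA : A.IsIrreducible) :
    HasNonnegRecursion A ↔ ∀ t : ℝ, 0 < t → (t : ℂ) ∈ spec A → t = r := by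
  constructor
  · rintro ⟨N, c, hc, hN⟩ t ht hts
    exact eq_of_pow_eq_sum hc ht h.pos (pow_eq_sum_of_mem_spec hN hts)
      (pow_eq_sum_of_mem_spec hN (h.mem_spec hn))
  · intro huniq
    obtain ⟨-, -, A₂, -, -, -, hchar, hne⟩ := h.exists_splitting hn hA
    obtain ⟨N, R, hd, hR, hRN⟩ := exists_dvd_X_pow_sub_of_rotation h.pos (charpoly_monic A) hchar
      hne
      (fun z hz => h.norm_le hA (mem_spec_iff.2 hz))
      (fun z hz hzr j hj => by
        rw [charpoly_natDegree_eq_dim, Fintype.card_fin]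
        exact h.pow_eq_one_of_coeff_ne_zero hA (mem_spec_iff.2 hz) hzr hj)
      (fun t ht ht0 => huniq t ht (mem_spec_iff.2 (aeval_ofReal_eq_zero_iff.2 ht0)))
    exact HasNonnegRecursion.of_charpoly_dvd hd hR hRN

/-! ### The reachable cones -/

/-- The cone generated by `b, A b, …, A ^ (k - 1) b`. -/
def krylovCone (k : ℕ) (A : Matrix (Fin n) (Fin n) ℝ) (b : Fin n → ℝ) :
    PointedCone ℝ (Fin n → ℝ) :=
  Submodule.span _ (Set.range fun i : Fin k => (A ^ (i : ℕ)) *ᵥ b)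

variable {b : Fin n → ℝ}

lemma mem_krylovCone {k : ℕ} {x : Fin n → ℝ} :
    x ∈ krylovCone k A b ↔
      ∃ c : Fin k → ℝ, (∀ i, 0 ≤ c i) ∧ ∑ i, c i • ((A ^ (i : ℕ)) *ᵥ b) = x := by
  rw [krylovCone, Submodule.mem_span_range_iff_exists_fun]
  constructor
  · rintro ⟨c, hc⟩
    exact ⟨fun i => c i, fun i => (c i).2, hc⟩
  · rintro ⟨c, hc, hx⟩
    exact ⟨fun i => ⟨c i, hc i⟩, hx⟩

lemma pow_mulVec_mem_krylovCone {i k : ℕ} (h : i < k) : (A ^ i) *ᵥ b ∈ krylovCone k A b :=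
  Submodule.subset_span ⟨⟨i, h⟩, rfl⟩

lemma krylovCone_mono {j k : ℕ} (h : j ≤ k) : krylovCone j A b ≤ krylovCone k A b := by
  refine Submodule.span_le.2 ?_
  rintro _ ⟨i, rfl⟩
  exact pow_mulVec_mem_krylovCone (i.2.trans_le h)

lemma state_eq_sum (u : ℕ → ℝ) (k : ℕ) :
    state A b 0 u k = ∑ i ∈ Finset.range k, u (k - 1 - i) • ((A ^ i) *ᵥ b) := by
  induction k with
  | zero => rfl
  | succ k ih =>
    rw [Finset.sum_range_succ', state, ih, mulVec_sum]
    congr 1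
    · refine Finset.sum_congr rfl fun i _ => ?_
      rw [mulVec_smul, mulVec_mulVec, ← pow_succ', show k + 1 - 1 - (i + 1) = k - 1 - i by omega]
    · simp

lemma conset_eq_krylovCone (hA : ∀ i j, 0 ≤ A i j) (hb : ∀ i, 0 ≤ b i) (k : ℕ) :
    conset k A b = krylovCone k A b := by
  ext x
  rw [SetLike.mem_coe, mem_krylovCone]
  constructor
  · rintro ⟨-, u, hu, rfl⟩
    refine ⟨fun i => u (k - 1 - i), fun i => hu _, ?_⟩
    rw [state_eq_sum, Finset.sum_range]
  · rintro ⟨c, hc, rfl⟩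
    refine ⟨fun i => ?_, fun t => if h : k - 1 - t < k then c ⟨k - 1 - t, h⟩ else 0,
      fun t => ?_, ?_⟩
    · rw [Finset.sum_apply]
      refine Finset.sum_nonneg fun j _ => mul_nonneg (hc j) ?_
      rw [mulVec_apply]
      exact Finset.sum_nonneg fun l _ => mul_nonneg (pow_apply_nonneg hA _ i l) (hb l)
    · dsimp only
      split_ifs
      exacts [hc _, le_rfl]
    · rw [state_eq_sum, Finset.sum_range]
      refine Finset.sum_congr rfl fun i _ => ?_
      have h1 : k - 1 - (k - 1 - (i : ℕ)) = i := by omega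
      simp only [h1, i.2, dif_pos, Fin.eta]

/-- If `A ^ N b` lies in the cone generated by the earlier iterates, this cone contains all
reachable states. -/
lemma consetF_eq_conset_of_mem (hA : ∀ i j, 0 ≤ A i j) (hb : ∀ i, 0 ≤ b i) {N : ℕ} (hN0 : 0 < N)
    (hN : (A ^ N) *ᵥ b ∈ conset N A b) : consetF A b = conset N A b := by
  refine subset_antisymm (Set.iUnion_subset fun k => ?_)
    (Set.subset_iUnion (fun k => conset k A b) N)
  rw [conset_eq_krylovCone hA hb, SetLike.mem_coe] at hN
  have hstep : ∀ x ∈ krylovCone N A b, A *ᵥ x ∈ krylovCone N A b := by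
    intro x hx
    obtain ⟨c, hc, rfl⟩ := mem_krylovCone.1 hx
    rw [mulVec_sum]
    refine Submodule.sum_mem _ fun i _ => ?_
    rw [mulVec_smul, mulVec_mulVec, ← pow_succ']
    refine Submodule.smul_mem _ (⟨c i, hc i⟩ : {c : ℝ // 0 ≤ c}) ?_
    rcases (Nat.succ_le_of_lt i.2).eq_or_lt with h | h
    · rw [show (i : ℕ) + 1 = N from h]; exact hN
    · exact pow_mulVec_mem_krylovCone h
  have hpow : ∀ i, (A ^ i) *ᵥ b ∈ krylovCone N A b := by
    intro i
    induction i with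
    | zero => exact pow_mulVec_mem_krylovCone hN0
    | succ i ih =>
      rw [pow_succ', ← mulVec_mulVec]
      exact hstep _ ih
  rw [conset_eq_krylovCone hA hb, conset_eq_krylovCone hA hb]
  refine SetLike.coe_subset_coe.2 (Submodule.span_le.2 ?_)
  rintro _ ⟨i, rfl⟩
  exact hpow i

lemma isPolyhedralCone_conset (hA : ∀ i j, 0 ≤ A i j) (hb : ∀ i, 0 ≤ b i) (k : ℕ) :
    IsPolyhedralCone (conset k A b) :=
  ⟨krylovCone k A b, Submodule.fg_span (Set.finite_range _), (conset_eq_krylovCone hA hb k).symm⟩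

lemma exists_consetF_eq_conset (hA : ∀ i j, 0 ≤ A i j) (hb : ∀ i, 0 ≤ b i)
    (h : IsPolyhedralCone (consetF A b)) : ∃ N, consetF A b = conset N A b := by
  obtain ⟨C, ⟨s, hs⟩, hC⟩ := h
  have hmem : ∀ x ∈ s, ∃ k, x ∈ krylovCone k A b := by
    intro x hx
    have h1 : x ∈ consetF A b := by
      rw [← hC, ← hs]
      exact Submodule.subset_span hx
    obtain ⟨k, hk⟩ := Set.mem_iUnion.1 h1
    rw [conset_eq_krylovCone hA hb] at hk
    exact ⟨k, hk⟩
  choose! k hk using hmem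
  refine ⟨s.sup k, subset_antisymm ?_ (Set.subset_iUnion (fun k => conset k A b) _)⟩
  rw [← hC, ← hs, conset_eq_krylovCone hA hb]
  refine SetLike.coe_subset_coe.2 (Submodule.span_le.2 fun x hx => ?_)
  exact krylovCone_mono (Finset.le_sup (f := k) hx) (hk x hx)

/-- A matrix that commutes with `A` is determined by its value at a cyclic vector of `A`. -/
lemma eq_zero_of_commute_of_mulVec_eq_zero (hrank : (conmat n A b).rank = n)
    {M : Matrix (Fin n) (Fin n) ℝ} (hM : Commute M A) (hMb : M *ᵥ b = 0) : M = 0 := by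
  have hcol : M * conmat n A b = 0 := by
    ext i j
    have h1 : M *ᵥ ((A ^ (j : ℕ)) *ᵥ b) = 0 := by
      rw [mulVec_mulVec, (hM.pow_right j).eq, ← mulVec_mulVec, hMb, mulVec_zero]
    exact congrFun h1 i
  -- `M` annihilates the columns of the controllability matrix, which span the space.
  have htop : LinearMap.range (conmat n A b).mulVecLin = ⊤ := by
    refine Submodule.eq_top_of_finrank_eq ?_
    rw [Module.finrank_fin_fun]
    exact hrank
  refine ext_of_mulVec_single fun i => ?_
  obtain ⟨y, hy⟩ := LinearMap.range_eq_top.1 htop (Pi.single i 1)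
  rw [← hy, mulVecLin_apply, mulVec_mulVec, hcol, zero_mulVec, zero_mulVec]

lemma HasNonnegRecursion.exists_pow_mulVec_mem_conset (hn : 1 ≤ n) (hA : ∀ i j, 0 ≤ A i j)
    (hb : ∀ i, 0 ≤ b i) (h : HasNonnegRecursion A) :
    ∃ N, 0 < N ∧ (A ^ N) *ᵥ b ∈ conset N A b := by
  obtain ⟨N, c, hc, hN⟩ := h
  refine ⟨N, ?_, ?_⟩
  · rw [Nat.pos_iff_ne_zero]
    rintro rfl
    have h1 := congrFun (congrFun hN ⟨0, hn⟩) ⟨0, hn⟩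
    simp at h1
  · rw [conset_eq_krylovCone hA hb, SetLike.mem_coe, mem_krylovCone]
    refine ⟨c, hc, ?_⟩
    rw [hN, Matrix.sum_mulVec]
    simp only [smul_mulVec]

lemma HasNonnegRecursion.of_pow_mulVec_mem_conset (hA : ∀ i j, 0 ≤ A i j) (hb : ∀ i, 0 ≤ b i)
    (hrank : (conmat n A b).rank = n) {N : ℕ} (h : (A ^ N) *ᵥ b ∈ conset N A b) :
    HasNonnegRecursion A := by
  rw [conset_eq_krylovCone hA hb, SetLike.mem_coe, mem_krylovCone] at h
  obtain ⟨c, hc, hN⟩ := h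
  refine ⟨N, c, hc, ?_⟩
  rw [← sub_eq_zero]
  refine eq_zero_of_commute_of_mulVec_eq_zero hrank ?_ ?_
  · refine Commute.sub_left ((Commute.refl A).pow_left N) (Commute.sum_left _ _ _ fun i _ => ?_)
    exact ((Commute.refl A).pow_left _).smul_left _
  · rw [sub_mulVec, Matrix.sum_mulVec, ← hN, sub_eq_zero]
    simp only [smul_mulVec]

end PositiveSystem

open PositiveSystem in
theorem mainTheorem1 (n : ℕ) (hn : 1 ≤ n) (A : Matrix (Fin n) (Fin n) ℝ) (b : Fin n → ℝ)
    (hA : A.IsIrreducible) (hb : ∀ i, 0 ≤ b i)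
    (hrank : (PositiveSystem.conmat n A b).rank = n) :
    (∃ S T A₂, PositiveSystem.IsPerronDecomposition A S T A₂) ∧
    ∀ S T A₂, PositiveSystem.IsPerronDecomposition A S T A₂ →
      List.TFAE
        [PositiveSystem.IsPolyhedralCone (PositiveSystem.consetF A b),
          ∃ kvert k : ℕ, PositiveSystem.IsVertexNumber A b kvert ∧ kvert ≤ k ∧
            PositiveSystem.consetF A b = PositiveSystem.conset k A b,
          PositiveSystem.HasNonnegRecursion A,
          ¬ ∃ r : ℝ, 0 < r ∧ Module.End.HasEigenvalue (Matrix.toLin' A₂) r] := by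
  obtain ⟨r, v, u, h⟩ := exists_isPerronTriple hn hA
  refine ⟨h.exists_isPerronDecomposition hn hA, fun S T A₂ hS => ?_⟩
  tfae_have 2 → 1 := by
    rintro ⟨-, k, -, -, hk⟩
    rw [hk]
    exact isPolyhedralCone_conset hA.nonneg hb k
  tfae_have 1 → 3 := by
    intro h1
    obtain ⟨N, hN⟩ := exists_consetF_eq_conset hA.nonneg hb h1
    refine HasNonnegRecursion.of_pow_mulVec_mem_conset hA.nonneg hb hrank (N := N) ?_
    rw [← hN]
    refine Set.mem_iUnion.2 ⟨N + 1, ?_⟩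
    rw [conset_eq_krylovCone hA.nonneg hb]
    exact pow_mulVec_mem_krylovCone N.lt_succ_self
  tfae_have 3 → 2 := by
    intro h3
    have hex := h3.exists_pow_mulVec_mem_conset hn hA.nonneg hb
    classical
    obtain ⟨h0, hmem⟩ := Nat.find_spec hex
    exact ⟨Nat.find hex, Nat.find hex, ⟨⟨h0, hmem⟩, fun j hj => Nat.find_min' hex hj⟩, le_rfl,
      consetF_eq_conset_of_mem hA.nonneg hb h0 hmem⟩
  tfae_have 3 ↔ 4 := by
    rw [h.hasNonnegRecursion_iff hn hA, not_exists]
    refine forall_congr' fun t => ?_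
    rw [hasEigenvalue_toLin'_iff, hS.spec_eq, h.rho_eq hn hA, Set.mem_sdiff,
      Set.mem_singleton_iff, Complex.ofReal_inj]
    tauto
  tfae_finish
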